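/- Let $G$ be a finite continuous tree, i.e. a nonempty connected, acyclic space that is the union of finitely many curves of finite length; any two points $p,q\in G$ are joined by a unique simple path, whose set of points is the closed segment $[p,q]$ and whose length is the distance $d(p,q)$. Let $n$ be the number of agents and let $f:G^n\to G$ be a mechanism. For a profile $a\in G^n$, an agent $i$ and a location $a_i'\in G$, write $(a_{-i},a_i')$ for the profile obtained from $a$ by replacing $a_i$ by $a_i'$. Agents have quadratic preferences: an agent located at $a_i$ strictly prefers $x$ to $y$ if and only if $d(a_i,x)<d(a_i,y)$. Thus $f$ is strategyproof (SP) if $d(a_i,f(a))\le d(a_i,f(a_{-i},a_i'))$ for all $a\in G^n$, all agents $i$ and all $a_i'\in G$. The mechanism $f$ is onto if for every $x\in G$ there is $a\in G^n$ with $f(a)=x$. The mechanism $f$ is tree monotone (TMON) if for all $a\in G^n$, all agents $i$, all $a_i'\in G$ and all $x,y\in G$ with $[x,y]\subseteq[a_i,a_i']\cap[f(a),f(a_{-i},a_i')]$, $$d(a_i,x)<d(a_i,y)\iff d(f(a),x)<d(f(a),y).$$ The mechanism $f$ is trajectory contained (TC) if for all $a\in G^n$, all agents $i$ and all $a_i'\in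 G$, writing $a'=(a_{-i},a_i')$, either $[f(a),f(a')]\subseteq[a_i,a_i']$ or $f(a)=f(a')$. Theorem. An onto mechanism on a finite continuous tree is SP if and only if it is TMON and TC. -/

import Mathlib

open Set

/-- `γ`, restricted to `[0, L]`, is a simple path (an arc) from `p` to `q`.
For `p = q` this forces `L = 0`, so that only the constant path remains. -/
structure IsSimplePath {G : Type*} [MetricSpace G] (γ : ℝ → G) (L : ℝ) (p q : G) : Prop where
  nonneg : 0 ≤ L
  continuousOn : ContinuousOn γ (Icc 0 L)
  injOn : InjOn γ (Icc 0 L)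
  source : γ 0 = p
  target : γ L = q

/-- A finite continuous tree: a (nonempty) connected, acyclic, finite collection of curves of
finite length, with the path metric: `dist p q` is the length of the unique path from `p` to `q`.
The length of a path is its total variation. -/
structure IsFiniteContinuousTree (G : Type*) [MetricSpace G] : Prop where
  nonempty : Nonempty G
  /-- The space is the union of finitely many curves of finite length. -/
  curves : ∃ (m : ℕ) (γ : Fin m → ℝ → G) (L : Fin m → ℝ),
    (∀ e, IsSimplePath (γ e) (L e) (γ e 0) (γ e (L e))) ∧
    (∀ e, eVariationOn (γ e) (Icc 0 (L e)) ≠ ⊤) ∧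
    (⋃ e, γ e '' Icc 0 (L e)) = univ
  /-- Connected: any two points are joined by a path. -/
  connected : ∀ p q : G, ∃ (γ : ℝ → G) (L : ℝ), IsSimplePath γ L p q
  /-- Acyclic: any two simple paths between the same points trace the same set. -/
  acyclic : ∀ (p q : G) (γ δ : ℝ → G) (L M : ℝ),
    IsSimplePath γ L p q → IsSimplePath δ M p q → γ '' Icc 0 L = δ '' Icc 0 M
  /-- The distance of two points is the length of the path between them. -/
  edist_eq_length : ∀ (p q : G) (γ : ℝ → G) (L : ℝ),
    IsSimplePath γ L p q → edist p q = eVariationOn γ (Icc 0 L)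

/-- The closed segment `[p, q]`: the points on the path between `p` and `q`. -/
def treeSegment {G : Type*} [MetricSpace G] (p q : G) : Set G :=
  {z | ∃ (γ : ℝ → G) (L : ℝ), IsSimplePath γ L p q ∧ z ∈ γ '' Icc 0 L}

/-- A mechanism for `n` agents on `G`: it maps a profile of reported locations to a location. -/
abbrev Mechanism (n : ℕ) (G : Type*) := (Fin n → G) → G

namespace Mechanism

variable {n : ℕ} {G : Type*}

/-- Every location is the outcome of some profile. -/
def Onto (f : Mechanism n G) : Prop :=
  ∀ x : G, ∃ a : Fin n → G, f a = x

/-- No agent, who prefers outcomes closer to her location, gains by a false report.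
`Function.update a i b` is the profile `(a₋ᵢ, b)`. -/
def Strategyproof [MetricSpace G] (f : Mechanism n G) : Prop :=
  ∀ (a : Fin n → G) (i : Fin n) (b : G),
    dist (a i) (f a) ≤ dist (a i) (f (Function.update a i b))

/-- Tree monotone (TMON): on the common part of both trajectories, the facility moves in the same
direction as the agent. -/
def TreeMonotone [MetricSpace G] (f : Mechanism n G) : Prop :=
  ∀ (a : Fin n → G) (i : Fin n) (b x y : G),
    treeSegment x y ⊆ treeSegment (a i) b ∩ treeSegment (f a) (f (Function.update a i b)) →
      (dist (a i) x < dist (a i) y ↔ dist (f a) x < dist (f a) y)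

/-- Trajectory contained (TC): either the facility does not move, or its trajectory lies inside
the trajectory of the moving agent. -/
def TrajectoryContained [MetricSpace G] (f : Mechanism n G) : Prop :=
  ∀ (a : Fin n → G) (i : Fin n) (b : G),
    treeSegment (f a) (f (Function.update a i b)) ⊆ treeSegment (a i) b ∨
      f a = f (Function.update a i b)

end Mechanism

/-! By additivity of length, segments are metric intervals, and the tree is `0`-hyperbolic with
intermediate points; the rest uses only `Between`. The core is `between_outcome`: under SP, `f a`
lies between `a i` and any outcome agent `i` can reach. SP makes `f a` nearest to `a i` among these
outcomes, and they form a convex set (`metricConvex_optionSet`, via `metricConvex_of_nearest`), so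
`f a` is a projection. Used for a report and for its reversal, this puts `a i`, `f a`, `f a'`, `b`
in order on one segment, giving TC; along `[f a, f a']` the distances to `a i` and to `f a` differ
by a constant, giving TMON. Conversely, when the outcome moves, TMON applied to its two endpoints,
allowed by TC, is the SP inequality. -/

/-! ### Metric betweenness -/

/-- `z` lies metrically between `p` and `q`. -/
def Between {G : Type*} [MetricSpace G] (p z q : G) : Prop :=
  dist p z + dist z q = dist p q

/-- A set containing all points metrically between any two of its points. -/
def MetricConvex {G : Type*} [MetricSpace G] (S : Set G) : Prop :=
  ∀ x ∈ S, ∀ y ∈ S, ∀ z, Between x z y → z ∈ S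

/-- The four-point condition characterizing `0`-hyperbolic metric spaces. -/
def FourPoint (G : Type*) [MetricSpace G] : Prop :=
  ∀ p q x y : G, dist x y + dist p q ≤ dist p x + dist q y ∨
    dist x y + dist p q ≤ dist p y + dist q x

/-- Points at every intermediate distance exist between any two points. -/
def HasIntermediatePoints (G : Type*) [MetricSpace G] : Prop :=
  ∀ (p q : G) (t : ℝ), 0 ≤ t → t ≤ dist p q → ∃ z, dist p z = t ∧ dist z q = dist p q - t

section Betweenness

variable {G : Type*} [MetricSpace G]

lemma Between.symm {p z q : G} (h : Between p z q) : Between q z p := by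
  unfold Between at *
  rw [dist_comm q z, dist_comm z p, dist_comm q p]
  linarith

/-- The two segments overlap in `[w, z]`; the other four-point alternative would force `dist w z ≤
0`. -/
lemma FourPoint.between_chain (h4 : FourPoint G) {p w z b : G} (h1 : Between p w z)
    (h2 : Between w z b) (hne : w ≠ z) : Between p z b := by
  unfold Between at *
  have hpos := dist_pos.2 hne
  have ht := dist_triangle p z b
  rcases h4 p z w b with h | h
  · linarith
  · rw [dist_comm z w] at h
    linarith

lemma FourPoint.dist_eq_sub (h4 : FourPoint G) {p q u v : G} (hu : Between p u q)
    (hv : Between p v q) (huv : dist p u ≤ dist p v) : dist u v = dist p v - dist p u := by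
  unfold Between at *
  have ht := dist_triangle p u v
  rcases h4 p q u v with h | h
  · rw [dist_comm q v] at h
    linarith
  · rw [dist_comm q u] at h
    linarith

lemma FourPoint.exists_median (h4 : FourPoint G) (hI : HasIntermediatePoints G) (p q r : G) :
    ∃ m, Between p m q ∧ Between p m r ∧ Between q m r := by
  have t1 := dist_triangle p q r
  have t2 := dist_triangle q p r
  have t3 := dist_triangle p r q
  rw [dist_comm q p] at t2
  rw [dist_comm r q] at t3
  -- The Gromov product of `q` and `r` at `p`.
  obtain ⟨m, h1, h2⟩ := hI p q ((dist p q + dist p r - dist q r) / 2) (by linarith) (by linarith)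
  have s1 := dist_triangle p m r
  have s2 := dist_triangle q m r
  rw [dist_comm q m] at s2
  refine ⟨m, ?_, ?_, ?_⟩ <;> unfold Between <;> try rw [dist_comm q m]
  · linarith
  · rcases h4 p q m r with h | h
    · linarith
    · rw [dist_comm q m] at h
      linarith
  · rcases h4 p q m r with h | h
    · linarith
    · rw [dist_comm q m] at h
      linarith

/-- The median of `p`, `x`, `y` lies in `O` by convexity and on `[p, x]`, so minimality makes it
`x`. -/
lemma MetricConvex.between_of_nearest (h4 : FourPoint G) (hI : HasIntermediatePoints G)
    {O : Set G} (hO : MetricConvex O) {p x y : G} (hx : x ∈ O) (hy : y ∈ O)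
    (hmin : ∀ o ∈ O, dist p x ≤ dist p o) : Between p x y := by
  obtain ⟨m, h1, h2, h3⟩ := h4.exists_median hI p x y
  have hm := hmin m (hO x hx y hy m h3)
  have hmx : m = x := by
    unfold Between at h1
    exact dist_le_zero.1 (by linarith)
  rwa [hmx] at h2

/-- A subset `O` of a convex set is convex when it admits nearest points `F z` that are no farther
than `z` from a fixed point `p`. -/
lemma metricConvex_of_nearest (h4 : FourPoint G) (hI : HasIntermediatePoints G) {R O : Set G}
    (hR : MetricConvex R) (hOR : O ⊆ R) (p : G) (F : G → G) (hF : ∀ z, F z ∈ O)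
    (hmin : ∀ z, ∀ o ∈ O, dist z (F z) ≤ dist z o) (hp : ∀ z ∈ R, dist p (F z) ≤ dist p z) :
    MetricConvex O := by
  have toward : ∀ z ∈ R, Between z (F z) p := by
    intro z hz
    obtain ⟨w, hw1, hw2, hw3⟩ := h4.exists_median hI z (F z) p
    by_cases hwF : w = F z
    · rwa [hwF] at hw2
    exfalso
    have hpos := dist_pos.2 hwF
    -- If `[z, F z]` branches off `[z, p]` at `w`, then `F z'`, for `z'` past `w`, lies beyond `z'`
    -- as seen from `p`, against `hp`.
    obtain ⟨z', h1, h2⟩ := hI w (F z) (dist w (F z) / 2) (by linarith) (by linarith)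
    have hwz' : w ≠ z' := dist_pos.1 (by linarith)
    have hb : Between w z' (F z) := by unfold Between; linarith
    have hzw : Between z w z' := by
      unfold Between at *; linarith [dist_triangle z w z', dist_triangle z z' (F z)]
    have hzb : Between z z' (F z) := h4.between_chain hzw hb hwz'
    have hz'R : z' ∈ R := hR z hz _ (hOR (hF z)) z' hzb
    have m1 := hmin z' _ (hF z)
    have m2 := hmin z _ (hF z')
    have hzb' : Between z z' (F z') := by
      unfold Between at *; linarith [dist_triangle z z' (F z')]
    have hwb' : Between w z' (F z') := by
      unfold Between at *; linarith [dist_triangle z w (F z'), dist_triangle w z' (F z')]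
    have hpw : Between p w z' := by
      have := hw3.symm
      unfold Between at *
      linarith [dist_triangle p w z', dist_triangle p z' (F z)]
    have hfin := h4.between_chain hpw hwb' hwz'
    have hle := hp z' hz'R
    unfold Between at *
    linarith
  have inner : ∀ y ∈ O, ∀ z ∈ R, Between p z y → z ∈ O := by
    intro y hy z hz hpzy
    by_contra hzO
    have hr : 0 < dist z (F z) := dist_pos.2 fun h => hzO (h ▸ hF z)
    set r := dist z (F z) with hr_def
    set A : Set ℝ := {t | ∃ o ∈ O, Between z o y ∧ dist z o = t} with hA
    have hAne : A.Nonempty := ⟨dist z y, y, hy, by simp [Between], rfl⟩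
    have hAr : ∀ t ∈ A, r ≤ t := by
      rintro t ⟨o, ho, -, rfl⟩
      exact hmin z o ho
    have hbdd : BddBelow A := ⟨r, hAr⟩
    have hrs : r ≤ sInf A := le_csInf hAne hAr
    obtain ⟨t, ⟨o, ho, hzoy, rfl⟩, ht⟩ :=
      exists_lt_of_csInf_lt hAne (show sInf A < sInf A + r / 3 by linarith)
    have hot : sInf A ≤ dist z o := csInf_le hbdd ⟨o, ho, hzoy, rfl⟩
    have hoy : dist z o ≤ dist z y := by
      unfold Between at hzoy; linarith [dist_nonneg (x := o) (y := y)]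
    -- `v` is within `2r/3` of `o` and at least `2r/3` from `z`. So `F v`, which lies from `v`
    -- towards `p`, falls on `[z, v]`, below the infimum.
    obtain ⟨v, hv1, hv2⟩ := hI z y (sInf A - r / 3) (by linarith) (by linarith)
    have hzvy : Between z v y := by unfold Between; linarith
    have hvR : v ∈ R := hR z hz y (hOR hy) v hzvy
    have hvo := h4.dist_eq_sub hzvy hzoy (by linarith)
    have hle := hmin v o ho
    have hvzp : Between v z p := Between.symm (by
      unfold Between at *; linarith [dist_triangle p v y, dist_triangle p z v])
    have hvz : dist v z = sInf A - r / 3 := by rw [dist_comm, hv1]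
    have hbz := h4.dist_eq_sub (toward v hvR) hvzp (by linarith)
    rw [dist_comm (F v) z] at hbz
    have hmem : dist z (F v) ∈ A := by
      refine ⟨F v, hF v, ?_, rfl⟩
      unfold Between at *
      linarith [dist_triangle z (F v) y, dist_triangle (F v) v y, dist_comm (F v) v]
    have := csInf_le hbdd hmem
    linarith [dist_nonneg (x := v) (y := F v)]
  intro x hx y hy z hz
  have hzR := hR x (hOR hx) y (hOR hy) z hz
  -- `[x, y]` is covered by `[p, x]` and `[p, y]`.
  rcases h4 x y p z with h | h
  · refine inner x hx z hzR ?_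
    unfold Between at *
    linarith [dist_triangle p z x, dist_comm x p, dist_comm y z, dist_comm z x]
  · refine inner y hy z hzR ?_
    unfold Between at *
    linarith [dist_triangle p z y, dist_comm y p, dist_comm x z, dist_comm z y]

end Betweenness

/-! ### Simple paths -/

namespace IsSimplePath

variable {G : Type*} [MetricSpace G]

lemma reverse {γ : ℝ → G} {L : ℝ} {p q : G} (h : IsSimplePath γ L p q) :
    IsSimplePath (fun t => γ (L - t)) L q p where
  nonneg := h.nonneg
  continuousOn := h.continuousOn.comp (by fun_prop)
    fun t ht => ⟨by linarith [ht.2], by linarith [ht.1]⟩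
  injOn s hs t ht hst := by
    have := h.injOn (⟨by linarith [hs.2], by linarith [hs.1]⟩ : L - s ∈ Icc 0 L)
      (⟨by linarith [ht.2], by linarith [ht.1]⟩ : L - t ∈ Icc 0 L) hst
    linarith
  source := by simp [h.target]
  target := by simp [h.source]

lemma subpath {γ : ℝ → G} {L : ℝ} {p q : G} (h : IsSimplePath γ L p q) {s t : ℝ}
    (hs : 0 ≤ s) (hst : s ≤ t) (ht : t ≤ L) :
    IsSimplePath (fun u => γ (s + u)) (t - s) (γ s) (γ t) where
  nonneg := by linarith
  continuousOn := h.continuousOn.comp (by fun_prop)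
    fun u hu => ⟨by linarith [hu.1], by linarith [hu.2]⟩
  injOn u hu v hv huv := by
    have := h.injOn (⟨by linarith [hu.1], by linarith [hu.2]⟩ : s + u ∈ Icc 0 L)
      (⟨by linarith [hv.1], by linarith [hv.2]⟩ : s + v ∈ Icc 0 L) huv
    linarith
  source := by simp
  target := by simp

lemma trans {α β : ℝ → G} {A B : ℝ} {x m y : G} (hα : IsSimplePath α A x m)
    (hβ : IsSimplePath β B m y)
    (hdisj : ∀ s ∈ Icc 0 A, ∀ t ∈ Icc 0 B, α s = β t → s = A) :
    IsSimplePath (fun t => if t ≤ A then α t else β (t - A)) (A + B) x y where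
  nonneg := add_nonneg hα.nonneg hβ.nonneg
  continuousOn := by
    have hA := hα.nonneg
    have hB := hβ.nonneg
    rw [← Icc_union_Icc_eq_Icc hA (by linarith : A ≤ A + B)]
    refine ContinuousOn.union_of_isClosed ?_ ?_ isClosed_Icc isClosed_Icc
    · exact hα.continuousOn.congr fun t ht => by simp [ht.2]
    · have : ContinuousOn (fun t => β (t - A)) (Icc A (A + B)) :=
        hβ.continuousOn.comp (by fun_prop) fun t ht => ⟨by linarith [ht.1], by linarith [ht.2]⟩
      refine this.congr fun t ht => ?_
      rcases ht.1.eq_or_lt with rfl | hlt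
      · simp [hα.target, hβ.source]
      · simp [not_le.2 hlt]
  injOn := by
    intro s hs t ht hst
    have key : ∀ u v, u ∈ Icc 0 (A + B) → v ∈ Icc 0 (A + B) → u ≤ A → ¬ v ≤ A →
        α u ≠ β (v - A) := by
      intro u v hu hv hua hva heq
      have hvB : v - A ∈ Icc 0 B := ⟨by linarith, by linarith [hv.2]⟩
      have huA := hdisj u ⟨hu.1, hua⟩ _ hvB heq
      rw [huA, hα.target, ← hβ.source] at heq
      have := hβ.injOn ⟨le_rfl, hβ.nonneg⟩ hvB heq
      exact hva (by linarith)
    by_cases h1 : s ≤ A <;> by_cases h2 : t ≤ A <;> simp only [h1, h2, if_true, if_false] at hst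
    · exact hα.injOn ⟨hs.1, h1⟩ ⟨ht.1, h2⟩ hst
    · exact (key s t hs ht h1 h2 hst).elim
    · exact (key t s ht hs h2 h1 hst.symm).elim
    · have := hβ.injOn (⟨by linarith, by linarith [hs.2]⟩ : s - A ∈ Icc 0 B)
        (⟨by linarith, by linarith [ht.2]⟩ : t - A ∈ Icc 0 B) hst
      linarith
  source := by simp [hα.nonneg, hα.source]
  target := by
    rcases hβ.nonneg.eq_or_lt with h0 | h0
    · subst h0
      simp [hα.target, ← hβ.target, hβ.source]
    · simp [not_le.2 h0, hβ.target]

end IsSimplePath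

/-! ### The metric of a finite continuous tree -/

namespace IsFiniteContinuousTree

variable {G : Type*} [MetricSpace G]

lemma edist_eq_subpath_length (hG : IsFiniteContinuousTree G) {γ : ℝ → G} {L : ℝ} {p q : G}
    (h : IsSimplePath γ L p q) {s t : ℝ} (hs : 0 ≤ s) (hst : s ≤ t) (ht : t ≤ L) :
    edist (γ s) (γ t) = eVariationOn γ (Icc s t) := by
  rw [hG.edist_eq_length _ _ _ _ (h.subpath hs hst ht)]
  have := eVariationOn.comp_eq_of_monotoneOn γ (t := Icc 0 (t - s)) (fun u => s + u)
    (fun u _ v _ huv => by simpa using huv)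
  simpa [Function.comp_def] using this

lemma between_path (hG : IsFiniteContinuousTree G) {γ : ℝ → G} {L : ℝ} {p q : G}
    (h : IsSimplePath γ L p q) {s t u : ℝ} (hs : 0 ≤ s) (hst : s ≤ t) (htu : t ≤ u)
    (hu : u ≤ L) : Between (γ s) (γ t) (γ u) := by
  have hadd := eVariationOn.Icc_add_Icc γ (s := univ) hst htu (mem_univ t)
  simp only [univ_inter] at hadd
  rw [← hG.edist_eq_subpath_length h hs hst (by linarith),
    ← hG.edist_eq_subpath_length h (by linarith) htu hu,
    ← hG.edist_eq_subpath_length h hs (by linarith) hu] at hadd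
  simp only [edist_dist] at hadd
  rw [← ENNReal.ofReal_add dist_nonneg dist_nonneg,
    ENNReal.ofReal_eq_ofReal_iff (by positivity) dist_nonneg] at hadd
  exact hadd

lemma between_path_endpoints (hG : IsFiniteContinuousTree G) {γ : ℝ → G} {L : ℝ} {p q : G}
    (h : IsSimplePath γ L p q) {t : ℝ} (ht : t ∈ Icc 0 L) : Between p (γ t) q := by
  have := hG.between_path h le_rfl ht.1 ht.2 le_rfl
  rwa [h.source, h.target] at this

lemma between_of_trans (hG : IsFiniteContinuousTree G) {α β : ℝ → G} {A B : ℝ} {x m y : G}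
    (hα : IsSimplePath α A x m) (hβ : IsSimplePath β B m y)
    (hdisj : ∀ s ∈ Icc 0 A, ∀ t ∈ Icc 0 B, α s = β t → s = A) : Between x m y := by
  have := hG.between_path_endpoints (hα.trans hβ hdisj) (t := A)
    ⟨hα.nonneg, by linarith [hβ.nonneg]⟩
  simpa [hα.target] using this

lemma hasIntermediatePoints (hG : IsFiniteContinuousTree G) : HasIntermediatePoints G := by
  intro p q t ht0 ht
  obtain ⟨γ, L, h⟩ := hG.connected p q
  have hc : ContinuousOn (fun s => dist p (γ s)) (Icc 0 L) :=
    continuous_dist.comp_continuousOn (continuousOn_const.prodMk h.continuousOn)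
  obtain ⟨s, hs, hst⟩ := intermediate_value_Icc h.nonneg hc
    (show t ∈ Icc (dist p (γ 0)) (dist p (γ L)) by simp [h.source, h.target, ht0, ht])
  have hb := hG.between_path_endpoints h hs
  simp only at hst
  exact ⟨γ s, hst, by unfold Between at hb; linarith⟩

/-- Every point has a projection to a given path, where the paths to both endpoints arrive. -/
lemma exists_projection (hG : IsFiniteContinuousTree G) {γ : ℝ → G} {L : ℝ} {p q : G}
    (h : IsSimplePath γ L p q) (r : G) :
    ∃ u ∈ Icc 0 L, Between r (γ u) p ∧ Between r (γ u) q := by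
  obtain ⟨δ, M, hδ⟩ := hG.connected r p
  have hK : IsClosed (γ '' Icc 0 L) := (isCompact_Icc.image_of_continuousOn h.continuousOn).isClosed
  have hS : IsCompact (Icc 0 M ∩ δ ⁻¹' (γ '' Icc 0 L)) :=
    isCompact_Icc.of_isClosed_subset
      (hδ.continuousOn.preimage_isClosed_of_isClosed isClosed_Icc hK) inter_subset_left
  -- Up to its first hit `δ s = γ u`, `δ` avoids `γ`, so continuing along `γ` either way stays
  -- simple.
  obtain ⟨s, ⟨hs, u, hu, hus⟩, hmin⟩ := hS.exists_isLeast
    ⟨M, ⟨hδ.nonneg, le_rfl⟩, 0, ⟨le_rfl, h.nonneg⟩, by rw [h.source, hδ.target]⟩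
  have hα := hδ.subpath le_rfl hs.1 hs.2
  rw [hδ.source, ← hus] at hα
  have first : ∀ t ∈ Icc 0 (s - 0), ∀ v ∈ Icc 0 L, δ (0 + t) = γ v → t = s - 0 := by
    intro t ht v hv htv
    have h1 : t ≤ s := by linarith [ht.2]
    have := hmin ⟨⟨ht.1, by linarith [hs.2]⟩, v, hv, by rw [← htv, zero_add]⟩
    linarith
  have hp := (h.subpath le_rfl hu.1 hu.2).reverse
  have hq := h.subpath hu.1 hu.2 le_rfl
  rw [h.source] at hp
  rw [h.target] at hq
  refine ⟨u, hu, hG.between_of_trans hα hp ?_, hG.between_of_trans hα hq ?_⟩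
  · exact fun t ht v hv htv =>
      first t ht _ ⟨by linarith [hv.2], by linarith [hv.1, hu.2]⟩ htv
  · exact fun t ht v hv htv =>
      first t ht _ ⟨by linarith [hv.1, hu.1], by linarith [hv.2]⟩ htv

lemma mem_treeSegment_iff (hG : IsFiniteContinuousTree G) {p q z : G} :
    z ∈ treeSegment p q ↔ Between p z q := by
  constructor
  · rintro ⟨γ, L, h, t, ht, rfl⟩
    exact hG.between_path_endpoints h ht
  · intro hz
    obtain ⟨γ, L, h⟩ := hG.connected p q
    obtain ⟨u, hu, h1, h2⟩ := hG.exists_projection h z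
    refine ⟨γ, L, h, u, hu, ?_⟩
    have h3 := hG.between_path_endpoints h hu
    have h1' := h1.symm
    unfold Between at *
    refine dist_le_zero.1 ?_
    linarith [dist_comm z p, dist_comm p (γ u), dist_comm z (γ u)]

lemma fourPoint (hG : IsFiniteContinuousTree G) : FourPoint G := by
  intro p q x y
  obtain ⟨γ, L, h⟩ := hG.connected p q
  -- The order of the two projections on the path decides which alternative holds.
  obtain ⟨u, hu, hxp, hxq⟩ := hG.exists_projection h x
  obtain ⟨v, hv, hyp, hyq⟩ := hG.exists_projection h y
  have key : ∀ (x y : G) (u v : ℝ), 0 ≤ u → u ≤ v → v ≤ L → Between x (γ u) p →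
      Between x (γ u) q → Between y (γ v) p → Between y (γ v) q →
      dist x y + dist p q ≤ dist p y + dist q x := by
    intro x y u v hu huv hv hxp hxq hyp hyq
    have b1 := hG.between_path h le_rfl hu huv hv
    have b2 := hG.between_path h hu huv hv le_rfl
    have b3 := hG.between_path_endpoints h ⟨hu, huv.trans hv⟩
    rw [h.source] at b1
    rw [h.target] at b2
    have t1 := dist_triangle4 x (γ u) (γ v) y
    unfold Between at *
    linarith [dist_comm y p, dist_comm x q, dist_comm x p, dist_comm y (γ v),
      dist_comm (γ v) p, dist_comm (γ u) p]
  rcases le_total u v with huv | huv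
  · exact Or.inr (key x y u v hu.1 huv hv.2 hxp hxq hyp hyq)
  · have := key y x v u hv.1 huv hu.2 hyp hyq hxp hxq
    rw [dist_comm y x] at this
    exact Or.inl this

end IsFiniteContinuousTree

/-! ### Strategyproof mechanisms -/

namespace Mechanism

variable {n : ℕ} {G : Type*}

/-- The outcomes that are possible when the agents in `T` report as in `a`. -/
def optionSet (f : Mechanism n G) (T : Finset (Fin n)) (a : Fin n → G) : Set G :=
  {x | ∃ b : Fin n → G, (∀ j ∈ T, b j = a j) ∧ f b = x}

variable [MetricSpace G]

/-- A coalition of agents located at `z` does not gain by false reports. -/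
lemma Strategyproof.dist_coalition_le {f : Mechanism n G} (hf : f.Strategyproof) (z : G)
    (b : Fin n → G) (U : Finset (Fin n)) :
    dist z (f fun j => if j ∈ U then z else b j) ≤ dist z (f b) := by
  induction U using Finset.induction_on with
  | empty => simp
  | insert i U hi ih =>
    refine le_trans ?_ ih
    have := hf (fun j => if j ∈ insert i U then z else b j) i (b i)
    have he : Function.update (fun j => if j ∈ insert i U then z else b j) i (b i) =
        fun j => if j ∈ U then z else b j := by
      funext j
      by_cases hj : j = i
      · subst hj; simp [hi]
      · simp [hj]
    rw [he] at this
    simpa using this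

lemma Strategyproof.dist_le_of_mem_optionSet {f : Mechanism n G} (hf : f.Strategyproof)
    {T : Finset (Fin n)} {a : Fin n → G} {z x : G} (hx : x ∈ f.optionSet T a) :
    dist z (f fun j => if j ∈ T then a j else z) ≤ dist z x := by
  obtain ⟨b, hb, rfl⟩ := hx
  have := hf.dist_coalition_le z b Tᶜ
  have he : (fun j => if j ∈ Tᶜ then z else b j) = fun j => if j ∈ T then a j else z := by
    funext j
    by_cases hj : j ∈ T <;> simp [hj, hb]
  rwa [he] at this

/-- Induction on the fixed agents: ontoness starts it, and fixing one more agent `i` is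
`metricConvex_of_nearest` with `p = a i`. -/
lemma Strategyproof.metricConvex_optionSet (h4 : FourPoint G) (hI : HasIntermediatePoints G)
    {f : Mechanism n G} (hf : f.Strategyproof) (honto : f.Onto) (T : Finset (Fin n))
    (a : Fin n → G) : MetricConvex (f.optionSet T a) := by
  induction T using Finset.induction_on with
  | empty =>
    intro x _ y _ z _
    obtain ⟨b, hb⟩ := honto z
    exact ⟨b, by simp, hb⟩
  | insert i T hi ih =>
    refine metricConvex_of_nearest h4 hI ih ?_ (a i)
      (fun z => f fun j => if j ∈ insert i T then a j else z) ?_ ?_ ?_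
    · rintro x ⟨b, hb, rfl⟩
      exact ⟨b, fun j hj => hb j (Finset.mem_insert_of_mem hj), rfl⟩
    · exact fun z => ⟨_, fun j hj => by simp only [hj, if_true], rfl⟩
    · exact fun z o ho => hf.dist_le_of_mem_optionSet ho
    · intro z hz
      -- An available `z` is chosen once all agents outside `T` report it, so agent `i` at `a i` can
      -- obtain `z` by reporting it.
      have h0 := hf.dist_le_of_mem_optionSet (z := z) hz
      rw [dist_self] at h0
      have h1 := dist_le_zero.1 h0
      have := hf (fun j => if j ∈ insert i T then a j else z) i z
      have he : Function.update (fun j => if j ∈ insert i T then a j else z) i z =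
          fun j => if j ∈ T then a j else z := by
        funext j
        by_cases hj : j = i
        · subst hj; simp [hi]
        · simp [hj]
      rw [he, ← h1] at this
      simpa using this

/-- The outcome for agent `i` is a projection: it lies between her location and any outcome that
she can obtain by another report. -/
lemma Strategyproof.between_outcome (h4 : FourPoint G) (hI : HasIntermediatePoints G)
    {f : Mechanism n G} (hf : f.Strategyproof) (honto : f.Onto) (a : Fin n → G) (i : Fin n)
    (b : G) : Between (a i) (f a) (f (Function.update a i b)) := by
  refine (hf.metricConvex_optionSet h4 hI honto {i}ᶜ a).between_of_nearest h4 hI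
    ⟨a, fun _ _ => rfl, rfl⟩ ⟨_, fun j hj => ?_, rfl⟩ ?_
  · exact Function.update_of_ne (by simpa using hj) _ _
  · rintro o ⟨c, hc, rfl⟩
    have he : Function.update a i (c i) = c := by
      funext j
      by_cases hj : j = i
      · subst hj; simp
      · simp [hj, hc j (by simpa using hj)]
    have := hf a i (c i)
    rwa [he] at this

end Mechanism

theorem mainTheorem2 {G : Type*} [MetricSpace G] (hG : IsFiniteContinuousTree G)
    (n : ℕ) (f : Mechanism n G) (hf : f.Onto) :
    f.Strategyproof ↔ (f.TreeMonotone ∧ f.TrajectoryContained) := by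
  have h4 := hG.fourPoint
  have hI := hG.hasIntermediatePoints
  constructor
  · intro hsp
    refine ⟨fun a i b x y hxy => ?_, fun a i b => ?_⟩
    · have hx := hG.mem_treeSegment_iff.1 (hxy (hG.mem_treeSegment_iff.2
        (by simp [Between] : Between x x y))).2
      have hy := hG.mem_treeSegment_iff.1 (hxy (hG.mem_treeSegment_iff.2
        (by simp [Between] : Between x y y))).2
      have h := hsp.between_outcome h4 hI hf a i b
      have key : ∀ u, Between (f a) u (f (Function.update a i b)) →
          dist (a i) u = dist (a i) (f a) + dist (f a) u := by
        intro u hu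
        unfold Between at *
        linarith [dist_triangle (a i) (f a) u,
          dist_triangle (a i) u (f (Function.update a i b))]
      rw [key x hx, key y hy, add_lt_add_iff_left]
    · by_cases hne : f a = f (Function.update a i b)
      · exact Or.inr hne
      left
      intro z hz
      rw [hG.mem_treeSegment_iff] at hz ⊢
      have h1 := hsp.between_outcome h4 hI hf a i b
      have h2 := hsp.between_outcome h4 hI hf (Function.update a i b) i (a i)
      simp only [Function.update_self, Function.update_idem, Function.update_eq_self] at h2
      have h3 := h4.between_chain h1 h2.symm hne
      have h2' := h2.symm
      unfold Between at *
      linarith [dist_triangle (a i) z b, dist_triangle (a i) (f a) z,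
        dist_triangle z (f (Function.update a i b)) b]
  · rintro ⟨hm, hc⟩ a i b
    rcases hc a i b with h | h
    · by_cases hne : f a = f (Function.update a i b)
      · rw [← hne]
      -- Here `x = f a`, so the right side of TMON reads `0 < dist (f a) y`.
      · exact ((hm a i b _ _ (subset_inter h Subset.rfl)).2
          (by simpa using hne)).le
    · rw [← h]
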